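/- Let $n\ge 1$, $k\ge 0$, let $A,C\in\mathbb R^{n\times n}$, $B,D\in\mathbb R^{n\times k}$, $L\in\mathbb R^{k\times n}$, $Q\in\mathbb R^{n\times n}$ and $R\in\mathbb R^{k\times k}$ be constant matrices, and assume that the block matrix $\begin{pmatrix}Q&L'\\L&R\end{pmatrix}$ is (symmetric) positive definite. Let $\mathcal C_0$ be the set of real symmetric positive definite $n\times n$ matrices, $\le$ the Loewner order, and for a symmetric matrix $X$ and $Y\in\mathcal C_0$ put $$M(X/Y)=\inf\{t\in\mathbb R: X\le tY\},\qquad m(X/Y)=\sup\{t\in\mathbb R: tY\le X\}.$$ The Thompson metric on $\mathcal C_0$ is $d_T(X,Y)=\log\max\{M(X/Y),M(Y/X)\}$. Let $M_t(P)$ denote the value at time $t\ge0$ of the maximal $\mathcal C_0$-valued $C^1$ solution, started at $P\in\mathcal C_0$ at time $0$, of the generalized Riccati differential equation $$\dot P=A'P+PA+C'PC+Q-(PB+C'PD+L')(R+D'PD)^{-1}(B'P+D'PC+L).$$ For $U\subset\mathcal C_0$ and $P\in U$, let $t_U(P)\in[-\infty,\infty]$ be the supremum of all real $b>0$ smaller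 than the lifetime of that solution such that $M_t(P)\in U$ for all $t\in[0,b)$ (with $t_U(P)=-\infty$ if there is no such $b$). Then the following hold. 1. Let $U\subset\mathcal C_0$ be open in the space of symmetric matrices with $\lambda U\subset U$ for all $\lambda\in(0,1]$, let $P_0\in\mathcal C_0$ be such that $P\le P_0$ for all $P\in U$, and let $\alpha=m\big((Q-L'R^{-1}L)/P_0\big)$. Then $\alpha>0$, and for all $P_1,P_2\in U$, $$d_T(M_t(P_1),M_t(P_2))\le e^{-\alpha t}\,d_T(P_1,P_2),\qquad 0\le t<\min\{t_U(P_1),t_U(P_2)\}.$$ 2. The flow is a strict contraction on $\mathcal C_0$: for all $P_1\ne P_2$ in $\mathcal C_0$ and $0<t<\min\{t_{\mathcal C_0}(P_1),t_{\mathcal C_0}(P_2)\}$, one has $d_T(M_t(P_1),M_t(P_2))<d_T(P_1,P_2)$. 3. The contraction is uniform on every set $S\subset\mathcal C_0$ that is bounded from above in the Loewner order, in the following two senses. (a) There is $\alpha>0$ such that $d_T(M_t(P_1),M_t(P_2))\le e^{-\alpha t}d_T(P_1,P_2)$ for all $P_1,P_2\in S$ and $0\le t<\min\{t_S(P_1),t_S(P_2)\}$.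 (b) For every $T>0$ there is $\alpha>0$ such that $d_T(M_t(P_1),M_t(P_2))\le e^{-\alpha t}d_T(P_1,P_2)$ for all $P_1,P_2\in S$ and all $0\le t\le T$ with $t<\min\{t_{\mathcal C_0}(P_1),t_{\mathcal C_0}(P_2)\}$. -/

import Mathlib

open scoped MatrixOrder

noncomputable section

namespace GRDE

section Flow

variable {E : Type*} [AddCommGroup E] [Module ℝ E] [TopologicalSpace E]
  [ContinuousAdd E] [ContinuousSMul ℝ E]

/-- `X` is a solution on `[0,b)`, `0 < b ≤ ∞`, of `X' = φ(X)`, `X(0) = x₀`, with values in the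
domain `𝒟`: a continuously differentiable function `[0,b) → 𝒟` (one-sided derivative at `0`). -/
def IsSolution (φ : E → E) (𝒟 : Set E) (x₀ : E) (b : EReal) (X : ℝ → E) : Prop :=
  0 < b ∧ X 0 = x₀ ∧
  (∀ t : ℝ, 0 ≤ t → (t : EReal) < b → X t ∈ 𝒟) ∧
  (∀ t : ℝ, 0 ≤ t → (t : EReal) < b → HasDerivWithinAt X (φ (X t)) (Set.Ici 0) t) ∧
  ContinuousOn (fun t => φ (X t)) {t : ℝ | 0 ≤ t ∧ (t : EReal) < b}

/-- The supremum of the existence times of solutions: the maximal solution started at `x₀`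
lives on `[0, lifetime φ 𝒟 x₀)`. It is `⊥` if there is no solution at all. -/
def lifetime (φ : E → E) (𝒟 : Set E) (x₀ : E) : EReal :=
  sSup {b : EReal | ∃ X : ℝ → E, IsSolution φ 𝒟 x₀ b X}

open Classical in
/-- The flow `M_t(x₀)`: the value at time `t` of a solution started at `x₀` that lives beyond time
`t` (junk value `0` for `t` beyond the lifetime). -/
def flow (φ : E → E) (𝒟 : Set E) (t : ℝ) (x₀ : E) : E :=
  if h : ∃ X : ℝ → E, ∃ b : EReal, (t : EReal) < b ∧ IsSolution φ 𝒟 x₀ b X then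
    Classical.choose h t
  else 0

/-- The first time `t_U(x₀)` at which the trajectory started at `x₀` leaves `U`:
`sup {b ∈ (0, lifetime) | M_t(x₀) ∈ U for all t ∈ [0,b)}`. -/
def exitTime (φ : E → E) (𝒟 : Set E) (U : Set E) (x₀ : E) : EReal :=
  sSup {e : EReal | ∃ b : ℝ, e = (b : EReal) ∧ 0 < b ∧ (b : EReal) < lifetime φ 𝒟 x₀ ∧
    ∀ t : ℝ, 0 ≤ t → t < b → flow φ 𝒟 t x₀ ∈ U}

end Flow

section Thompson

variable {n : ℕ}

/-- `M(X/Y) = inf {t | X ≤ tY}` in the Loewner order (for `Y` positive definite). -/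
def upperRatio (X Y : Matrix (Fin n) (Fin n) ℝ) : ℝ := sInf {t : ℝ | X ≤ t • Y}

/-- `m(X/Y) = sup {t | tY ≤ X}` in the Loewner order (for `Y` positive definite). -/
def lowerRatio (X Y : Matrix (Fin n) (Fin n) ℝ) : ℝ := sSup {t : ℝ | t • Y ≤ X}

/-- The Thompson part metric on positive definite matrices. -/
def thompson (X Y : Matrix (Fin n) (Fin n) ℝ) : ℝ :=
  Real.log (max (upperRatio X Y) (upperRatio Y X))

/-- The set of real positive definite (symmetric) matrices. -/
def posDefCone (n : ℕ) : Set (Matrix (Fin n) (Fin n) ℝ) := {P | P.PosDef}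

/-- `U` is a set of symmetric matrices that is open in the space of symmetric matrices. -/
def IsOpenInSym (U : Set (Matrix (Fin n) (Fin n) ℝ)) : Prop :=
  U ⊆ {P | P.IsSymm} ∧
    IsOpen ((fun P : {P : Matrix (Fin n) (Fin n) ℝ // P.IsSymm} => P.1) ⁻¹' U)

end Thompson

/-- The constant coefficients of a generalized Riccati differential equation. -/
structure Coeffs (n k : ℕ) where
  A : Matrix (Fin n) (Fin n) ℝ
  B : Matrix (Fin n) (Fin k) ℝ
  C : Matrix (Fin n) (Fin n) ℝ
  D : Matrix (Fin n) (Fin k) ℝ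
  L : Matrix (Fin k) (Fin n) ℝ
  Q : Matrix (Fin n) (Fin n) ℝ
  R : Matrix (Fin k) (Fin k) ℝ

namespace Coeffs

variable {n k : ℕ} (c : Coeffs n k)

/-- The right-hand side of the generalized Riccati differential equation. -/
def phi (P : Matrix (Fin n) (Fin n) ℝ) : Matrix (Fin n) (Fin n) ℝ :=
  c.A.transpose * P + P * c.A + c.C.transpose * P * c.C + c.Q
    - (P * c.B + c.C.transpose * P * c.D + c.L.transpose)
      * (c.R + c.D.transpose * P * c.D)⁻¹
      * (c.B.transpose * P + c.D.transpose * P * c.C + c.L)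

/-- The weight matrix `[[Q, L'], [L, R]]`. -/
def weight : Matrix (Fin n ⊕ Fin k) (Fin n ⊕ Fin k) ℝ :=
  Matrix.fromBlocks c.Q c.L.transpose c.L c.R

/-- The flow `M_t` of the equation `P' = phi P` on the set of positive definite matrices. -/
def M (t : ℝ) (P : Matrix (Fin n) (Fin n) ℝ) : Matrix (Fin n) (Fin n) ℝ :=
  flow c.phi (posDefCone n) t P

/-- The exit time `t_U(P)` of this flow. -/
def exit (U : Set (Matrix (Fin n) (Fin n) ℝ)) (P : Matrix (Fin n) (Fin n) ℝ) : EReal :=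
  exitTime c.phi (posDefCone n) U P

end Coeffs

end GRDE

end

/-! Completing the square shows that the Riccati field is a minimum over feedback gains `K`: `phi P
≤ lyap K P + cost K`, with equality at `K = gain P` (`lyap_add_cost`). Here `lyap K` is linear and
generates a positivity-preserving flow (`nonneg_of_lyapunov_le_deriv`), and `cost K` dominates the
Schur complement `W = Q - LᵀR⁻¹L > 0` (`schur_le_cost`).

Suppose `X₁ ≤ e^d X₂` initially, and put `x(s) = e^{-αs} d`, `μ = e^{-x}`, `Δ = X₂ - μ X₁`. With `K
= gain X₂`, the minimum property gives `Δ' ≥ lyap K Δ + (1 - μ) cost K - μ' X₁`. If `α X₁ ≤ W`, then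
`(1 - μ) cost K ≥ (1 - μ) α X₁ ≥ α x μ X₁ = μ' X₁`, so `Δ` stays nonnegative
(`IsTrajectory.le_exp_smul`). Exchanging the two trajectories yields the Thompson estimate with rate
`α`.

All the claims then reduce to finding `α > 0` with `α X ≤ W` along both trajectories: an upper bound
on the set suffices while they stay in it, and `exists_uniform_bound` supplies one on bounded time
intervals. -/

namespace GRDE

open Set Filter Topology Matrix

/-! ### Loewner order through quadratic forms. -/

section QuadraticForm

variable {n : ℕ}

/-- The quadratic form `v ↦ vᵀ H v` of a matrix. -/
def quad (H : Matrix (Fin n) (Fin n) ℝ) (v : Fin n → ℝ) : ℝ := v ⬝ᵥ H *ᵥ v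

lemma quad_add (H K : Matrix (Fin n) (Fin n) ℝ) (v : Fin n → ℝ) :
    quad (H + K) v = quad H v + quad K v := by
  simp [quad, add_mulVec]

lemma quad_sub (H K : Matrix (Fin n) (Fin n) ℝ) (v : Fin n → ℝ) :
    quad (H - K) v = quad H v - quad K v := by
  simp [quad, sub_mulVec]

lemma quad_smul (r : ℝ) (H : Matrix (Fin n) (Fin n) ℝ) (v : Fin n → ℝ) :
    quad (r • H) v = r * quad H v := by
  simp [quad, smul_mulVec]

lemma quad_one (v : Fin n → ℝ) : quad 1 v = v ⬝ᵥ v := by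
  simp [quad]

lemma quad_smul_right (r : ℝ) (H : Matrix (Fin n) (Fin n) ℝ) (v : Fin n → ℝ) :
    quad H (r • v) = r ^ 2 * quad H v := by
  simp [quad, mulVec_smul]; ring

lemma quad_transpose (H : Matrix (Fin n) (Fin n) ℝ) (v : Fin n → ℝ) :
    quad Hᵀ v = quad H v := by
  rw [quad, mulVec_transpose, dotProduct_comm, ← dotProduct_mulVec, quad]

lemma quad_transpose_mul_mul {m : ℕ} (H : Matrix (Fin m) (Fin m) ℝ) (G : Matrix (Fin m) (Fin n) ℝ)
    (v : Fin n → ℝ) : quad (Gᵀ * H * G) v = quad H (G *ᵥ v) := by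
  rw [quad, quad, Matrix.mul_assoc, ← mulVec_mulVec, ← mulVec_mulVec, mulVec_transpose,
    dotProduct_comm, ← dotProduct_mulVec, dotProduct_comm]

lemma quad_eq_sum (H : Matrix (Fin n) (Fin n) ℝ) (v : Fin n → ℝ) :
    quad H v = ∑ i, ∑ j, v i * H i j * v j := by
  simp [quad, dotProduct, mulVec, Finset.mul_sum, mul_assoc]

lemma continuous_quad :
    Continuous fun p : Matrix (Fin n) (Fin n) ℝ × (Fin n → ℝ) => quad p.1 p.2 := by
  unfold quad
  fun_prop

lemma posSemidef_iff_quad {H : Matrix (Fin n) (Fin n) ℝ} (hH : H.IsHermitian) :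
    H.PosSemidef ↔ ∀ v, 0 ≤ quad H v :=
  ⟨fun h v => by simpa [quad] using h.dotProduct_mulVec_nonneg v,
    fun h => .of_dotProduct_mulVec_nonneg hH fun v => by simpa [quad] using h v⟩

lemma quad_le_quad {H K : Matrix (Fin n) (Fin n) ℝ} (h : H ≤ K) (v : Fin n → ℝ) :
    quad H v ≤ quad K v := by
  have := (posSemidef_iff_quad h.1).1 h v
  rw [quad_sub] at this
  linarith

lemma le_iff_quad {H K : Matrix (Fin n) (Fin n) ℝ} (hH : H.IsHermitian) (hK : K.IsHermitian) :
    H ≤ K ↔ ∀ v, quad H v ≤ quad K v := by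
  rw [Matrix.le_iff, posSemidef_iff_quad (hK.sub hH)]
  simp [quad_sub]

lemma quad_pos {H : Matrix (Fin n) (Fin n) ℝ} (hH : H.PosDef) {v : Fin n → ℝ} (hv : v ≠ 0) :
    0 < quad H v := by
  simpa [quad] using hH.dotProduct_mulVec_pos hv

lemma exists_sphere_smul {v : Fin n → ℝ} (hv : v ≠ 0) :
    ∃ r : ℝ, 0 < r ∧ r • v ∈ Metric.sphere (0 : Fin n → ℝ) 1 := by
  have : 0 < ‖v‖ := norm_pos_iff.2 hv
  refine ⟨‖v‖⁻¹, by positivity, ?_⟩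
  simp [norm_smul, this.ne']

lemma ne_zero_of_mem_sphere {v : Fin n → ℝ} (hv : v ∈ Metric.sphere (0 : Fin n → ℝ) 1) :
    v ≠ 0 := by
  rintro rfl
  simp at hv

lemma dotProduct_self_pos_of_ne_zero {v : Fin n → ℝ} (hv : v ≠ 0) : 0 < v ⬝ᵥ v := by
  rw [← quad_one]
  exact quad_pos Matrix.PosDef.one hv

/-- An inequality between quadratic forms need only be checked on the unit sphere. -/
lemma quad_le_of_sphere {H K : Matrix (Fin n) (Fin n) ℝ}
    (h : ∀ v ∈ Metric.sphere (0 : Fin n → ℝ) 1, quad H v ≤ quad K v) (v : Fin n → ℝ) :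
    quad H v ≤ quad K v := by
  rcases eq_or_ne v 0 with rfl | hv
  · simp [quad]
  obtain ⟨r, hr, hrv⟩ := exists_sphere_smul hv
  have := h _ hrv
  rw [quad_smul_right, quad_smul_right] at this
  exact le_of_mul_le_mul_left this (by positivity)

/-- A continuous family of symmetric matrices over a compact set is bounded above. -/
lemma exists_le_smul_one {α : Type*} [TopologicalSpace α] {s : Set α} (hs : IsCompact s)
    {H : α → Matrix (Fin n) (Fin n) ℝ} (hH : ContinuousOn H s)
    (hsym : ∀ x ∈ s, (H x).IsHermitian) :
    ∃ c : ℝ, 0 < c ∧ ∀ x ∈ s, H x ≤ c • (1 : Matrix (Fin n) (Fin n) ℝ) := by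
  have hK : IsCompact (s ×ˢ Metric.sphere (0 : Fin n → ℝ) 1) := hs.prod (isCompact_sphere _ _)
  -- The norm is the sup norm, so `v ⬝ᵥ v` need not be 1 on its unit sphere; hence the Rayleigh
  -- quotient.
  have hf : ContinuousOn (fun p : α × (Fin n → ℝ) => quad (H p.1) p.2 / (p.2 ⬝ᵥ p.2))
      (s ×ˢ Metric.sphere (0 : Fin n → ℝ) 1) := by
    refine ContinuousOn.div ?_ (by fun_prop) fun p hp =>
      (dotProduct_self_pos_of_ne_zero (ne_zero_of_mem_sphere hp.2)).ne'
    exact continuous_quad.comp_continuousOn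
      ((hH.comp continuousOn_fst fun p hp => hp.1).prodMk continuousOn_snd)
  obtain ⟨c, hc⟩ := (hK.image_of_continuousOn hf).bddAbove
  refine ⟨max c 1, by positivity, fun x hx => ?_⟩
  rw [le_iff_quad (hsym x hx) (isHermitian_one.smul (by simp [IsSelfAdjoint]))]
  refine quad_le_of_sphere fun v hv => ?_
  have hp := dotProduct_self_pos_of_ne_zero (ne_zero_of_mem_sphere hv)
  have := hc ⟨(x, v), ⟨hx, hv⟩, rfl⟩
  rw [quad_smul, quad_one]
  rw [div_le_iff₀ hp] at this
  exact this.trans (by gcongr; exact le_max_left _ _)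

end QuadraticForm

/-! ### Comparison principle for Lyapunov-type differential inequalities. -/

section Comparison

variable {n : ℕ}

lemma hasDerivWithinAt_quad {X : ℝ → Matrix (Fin n) (Fin n) ℝ} {X' : Matrix (Fin n) (Fin n) ℝ}
    {s : Set ℝ} {t : ℝ} (h : HasDerivWithinAt X X' s t) (v : Fin n → ℝ) :
    HasDerivWithinAt (fun r => quad (X r) v) (quad X' v) s t := by
  have h1 : ∀ i j, HasDerivWithinAt (fun r => X r i j) (X' i j) s t := fun i =>
    hasDerivWithinAt_pi.1 ((hasDerivWithinAt_pi (φ := X) (φ' := X')).1 h i)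
  simp only [quad_eq_sum]
  refine HasDerivWithinAt.fun_sum fun i _ => HasDerivWithinAt.fun_sum fun j _ => ?_
  exact ((h1 i j).const_mul (v i)).mul_const (v j)

lemma continuousWithinAt_of_hasDerivWithinAt {X : ℝ → Matrix (Fin n) (Fin n) ℝ}
    {X' : Matrix (Fin n) (Fin n) ℝ} {s : Set ℝ} {t : ℝ} (h : HasDerivWithinAt X X' s t) :
    ContinuousWithinAt X s t :=
  continuousWithinAt_pi.2 fun i => ((hasDerivWithinAt_pi (φ := X) (φ' := X')).1 h i).continuousWithinAt

/-- A function that is positive before `t` and vanishes at `t` has nonpositive derivative at `t`. -/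
lemma deriv_nonpos_of_pos_left {f : ℝ → ℝ} {f' t : ℝ} (ht : 0 < t)
    (hf : HasDerivWithinAt f f' (Ici 0) t) (hpos : ∀ s, 0 ≤ s → s < t → 0 ≤ f s)
    (h0 : f t = 0) : f' ≤ 0 := by
  have hd : HasDerivAt f f' t := hf.hasDerivAt (Ici_mem_nhds ht)
  have := (hasDerivAt_iff_tendsto_slope_left_right.1 hd).1
  refine le_of_tendsto this ?_
  filter_upwards [Ioo_mem_nhdsLT ht] with s hs
  rw [slope_def_field, h0]
  have := hpos s hs.1.le hs.2
  exact div_nonpos_of_nonneg_of_nonpos (by linarith) (by linarith [hs.2])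

/-- In this form the `F`-term visibly vanishes at a kernel vector of `Δ`, leaving only a term that
is nonnegative when `Δ ≥ 0`. -/
lemma quad_lyapunov {Δ F G : Matrix (Fin n) (Fin n) ℝ} (hΔ : Δ.IsHermitian) (v : Fin n → ℝ) :
    quad (Fᵀ * Δ + Δ * F + Gᵀ * Δ * G) v = 2 * ((F *ᵥ v) ⬝ᵥ (Δ *ᵥ v)) + quad Δ (G *ᵥ v) := by
  have h1 : quad (Fᵀ * Δ) v = (F *ᵥ v) ⬝ᵥ (Δ *ᵥ v) := by
    rw [quad, ← mulVec_mulVec, mulVec_transpose, dotProduct_comm, ← dotProduct_mulVec,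
      dotProduct_comm]
  have h2 : quad (Δ * F) v = (F *ᵥ v) ⬝ᵥ (Δ *ᵥ v) := by
    rw [← h1, ← quad_transpose, transpose_mul]
    congr 2
  rw [quad_add, quad_add, quad_transpose_mul_mul, h1, h2]
  ring

/-- Positivity is propagated by the linear differential inequality
`dΔ/dt ≥ FᵀΔ + ΔF + GᵀΔG` with bounded coefficients. -/
theorem nonneg_of_lyapunov_le_deriv {b c : ℝ} (hb : 0 ≤ b)
    {Δ Δ' F G : ℝ → Matrix (Fin n) (Fin n) ℝ}
    (hs : ∀ s ∈ Icc 0 b, (Δ s).IsHermitian) (hcont : ContinuousOn Δ (Icc 0 b))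
    (hd : ∀ s ∈ Icc 0 b, ∀ v,
      HasDerivWithinAt (fun r => quad (Δ r) v) (quad (Δ' s) v) (Ici 0) s)
    (hge : ∀ s ∈ Icc 0 b, ∀ v,
      quad ((F s)ᵀ * Δ s + Δ s * F s + (G s)ᵀ * Δ s * G s) v ≤ quad (Δ' s) v)
    (hc : ∀ s ∈ Icc 0 b,
      (F s)ᵀ * 1 + 1 * F s + (G s)ᵀ * 1 * G s ≤ c • (1 : Matrix (Fin n) (Fin n) ℝ))
    (h0 : 0 ≤ Δ 0) : 0 ≤ Δ b := by
  rw [nonneg_iff_posSemidef, posSemidef_iff_quad (hs b ⟨hb, le_rfl⟩)]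
  -- Perturbing `Δ` by `e ε s • 1` makes positivity strict; the growth rate `c + 1` exceeds by one
  -- the bound `c` on the linear operator at the identity.
  set e : ℝ → ℝ → ℝ := fun ε s => ε * Real.exp ((c + 1) * s) with he
  have hepos : ∀ ε > 0, ∀ s, 0 < e ε s := fun ε hε s => by positivity
  suffices key : ∀ ε > 0, ∀ v ∈ Metric.sphere (0 : Fin n → ℝ) 1, ∀ s ∈ Icc 0 b,
      0 < quad (Δ s) v + e ε s * (v ⬝ᵥ v) by
    have hsph : ∀ v ∈ Metric.sphere (0 : Fin n → ℝ) 1, quad 0 v ≤ quad (Δ b) v := by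
      intro v hv
      have hlim : Tendsto (fun ε : ℝ => quad (Δ b) v + e ε b * (v ⬝ᵥ v)) (𝓝[>] 0)
          (𝓝 (quad (Δ b) v)) := by
        have : Continuous fun ε : ℝ => quad (Δ b) v + e ε b * (v ⬝ᵥ v) := by
          simp only [he]; fun_prop
        have := this.tendsto 0
        simp only [he, zero_mul, add_zero] at this
        exact this.mono_left nhdsWithin_le_nhds
      have : quad 0 v = 0 := by simp [quad]
      rw [this]
      refine ge_of_tendsto hlim ?_
      filter_upwards [self_mem_nhdsWithin] with ε hε
      exact (key ε hε v hv b ⟨hb, le_rfl⟩).le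
    intro v
    simpa [quad] using quad_le_of_sphere hsph v
  intro ε hε
  by_contra! hcon
  set S : Set (ℝ × (Fin n → ℝ)) := Icc 0 b ×ˢ Metric.sphere (0 : Fin n → ℝ) 1 with hS
  have hScomp : IsCompact S := isCompact_Icc.prod (isCompact_sphere _ _)
  have hfcont : ContinuousOn
      (fun p : ℝ × (Fin n → ℝ) => quad (Δ p.1) p.2 + e ε p.1 * (p.2 ⬝ᵥ p.2)) S := by
    refine ContinuousOn.add ?_ (by simp only [he]; fun_prop)
    exact continuous_quad.comp_continuousOn
      ((hcont.comp continuousOn_fst fun p hp => hp.1).prodMk continuousOn_snd)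
  -- `K` collects the pairs (time, direction) where strict positivity fails; compactness provides an
  -- earliest failure time `t` with direction `w`.
  set K := S ∩ (fun p : ℝ × (Fin n → ℝ) => quad (Δ p.1) p.2 + e ε p.1 * (p.2 ⬝ᵥ p.2)) ⁻¹' Iic 0
    with hK
  have hKcomp : IsCompact K :=
    hScomp.of_isClosed_subset (hfcont.preimage_isClosed_of_isClosed hScomp.isClosed isClosed_Iic)
      inter_subset_left
  have hKne : K.Nonempty := by
    obtain ⟨v, hv, s, hs', h⟩ := hcon
    exact ⟨(s, v), ⟨hs', hv⟩, h⟩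
  obtain ⟨⟨t, w⟩, ⟨⟨ht, hw⟩, hle⟩, hmin⟩ := hKcomp.exists_isMinOn hKne continuousOn_fst
  replace ht : t ∈ Icc 0 b := ht
  replace hw : w ∈ Metric.sphere (0 : Fin n → ℝ) 1 := hw
  simp only [mem_preimage, mem_Iic] at hle
  have hw0 := ne_zero_of_mem_sphere hw
  have hww := dotProduct_self_pos_of_ne_zero hw0
  have hbefore : ∀ s, 0 ≤ s → s < t → ∀ v ∈ Metric.sphere (0 : Fin n → ℝ) 1,
      0 < quad (Δ s) v + e ε s * (v ⬝ᵥ v) := by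
    intro s hs0 hst v hv
    by_contra! h
    have hmem : (s, v) ∈ K := ⟨⟨⟨hs0, hst.le.trans ht.2⟩, hv⟩, h⟩
    have : t ≤ s := hmin hmem
    linarith
  have htpos : 0 < t := by
    rcases ht.1.eq_or_lt with h | h
    · have h1 := quad_le_quad h0 w
      have h2 := hepos ε hε 0
      rw [← h] at hle
      have : quad 0 w = 0 := by simp [quad]
      nlinarith [mul_pos h2 hww]
    · exact h
  have hEq : ∀ s v, quad (Δ s) v + e ε s * (v ⬝ᵥ v) = quad (Δ s + e ε s • 1) v := fun s v => by
    rw [quad_add, quad_smul, quad_one]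
  have hEherm : (Δ t + e ε t • 1).IsHermitian :=
    (hs t ht).add (isHermitian_one.smul (by simp [IsSelfAdjoint]))
  have hEt : (Δ t + e ε t • 1).PosSemidef := by
    rw [posSemidef_iff_quad hEherm]
    have : ∀ v ∈ Metric.sphere (0 : Fin n → ℝ) 1, quad 0 v ≤ quad (Δ t + e ε t • 1) v := by
      intro v hv
      have hz : quad 0 v = 0 := by simp [quad]
      rw [hz, ← hEq]
      have hc1 : ContinuousWithinAt (fun s => quad (Δ s) v + e ε s * (v ⬝ᵥ v)) (Ici 0) t := by
        refine (hd t ht v).continuousWithinAt.add ?_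
        simp only [he]; fun_prop
      have hc2 := (hc1.continuousAt (Ici_mem_nhds htpos)).tendsto.mono_left
        (nhdsWithin_le_nhds (s := Iio t))
      refine ge_of_tendsto hc2 ?_
      filter_upwards [Ioo_mem_nhdsLT htpos] with s hs'
      exact (hbefore s hs'.1.le hs'.2 v hv).le
    intro v
    simpa [quad] using quad_le_of_sphere this v
  have hzero : quad (Δ t + e ε t • 1) w = 0 :=
    le_antisymm ((hEq t w) ▸ hle) ((posSemidef_iff_quad hEherm).1 hEt w)
  -- A positive semidefinite matrix annihilates any vector on which its form vanishes.
  have hker : (Δ t + e ε t • 1) *ᵥ w = 0 := by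
    apply (hEt.dotProduct_mulVec_zero_iff w).1
    simpa [quad] using hzero
  have hlyap : 0 ≤ quad ((F t)ᵀ * (Δ t + e ε t • 1) + (Δ t + e ε t • 1) * F t +
      (G t)ᵀ * (Δ t + e ε t • 1) * G t) w := by
    rw [quad_lyapunov hEherm, hker]
    simpa using (posSemidef_iff_quad hEherm).1 hEt _
  have hsplit : (F t)ᵀ * (Δ t + e ε t • 1) + (Δ t + e ε t • 1) * F t +
      (G t)ᵀ * (Δ t + e ε t • 1) * G t =
      ((F t)ᵀ * Δ t + Δ t * F t + (G t)ᵀ * Δ t * G t) +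
        e ε t • ((F t)ᵀ * 1 + 1 * F t + (G t)ᵀ * 1 * G t) := by
    simp only [mul_add, add_mul, mul_smul_comm, smul_mul_assoc, smul_add]
    abel
  have hder : HasDerivWithinAt (fun s => quad (Δ s) w + e ε s * (w ⬝ᵥ w))
      (quad (Δ' t) w + (c + 1) * e ε t * (w ⬝ᵥ w)) (Ici 0) t := by
    refine (hd t ht w).add ?_
    have : HasDerivAt (e ε) ((c + 1) * e ε t) t := by
      have := (((hasDerivAt_id' t).const_mul (c + 1)).exp).const_mul ε
      refine this.congr_deriv ?_
      simp only [he]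
      ring
    exact (this.mul_const _).hasDerivWithinAt
  have hnonpos := deriv_nonpos_of_pos_left htpos hder
    (fun s h1 h2 => (hbefore s h1 h2 w hw).le) (by rw [hEq, hzero])
  -- First contact forces a nonpositive derivative, while the differential inequality makes it at
  -- least `e ε t * (w ⬝ᵥ w) > 0`.
  rw [hsplit, quad_add, quad_smul] at hlyap
  have h1 := hge t ht w
  have h2 := quad_le_quad (hc t ht) w
  rw [quad_smul, quad_one] at h2
  have h3 := hepos ε hε t
  have h4 := mul_le_mul_of_nonneg_left h2 h3.le
  nlinarith [mul_pos h3 hww]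

end Comparison

end GRDE

namespace GRDE

open Set Filter Topology Matrix

/-! ### Attainment of the order ratios and basic properties of the Thompson metric. -/

section ThompsonMetric

variable {n : ℕ} {X Y : Matrix (Fin n) (Fin n) ℝ}

lemma isHermitian_real_smul (hX : X.IsHermitian) (r : ℝ) : (r • X).IsHermitian :=
  hX.smul (by simp [IsSelfAdjoint])

lemma exists_ne_zero_vec (hn : 0 < n) : ∃ v : Fin n → ℝ, v ≠ 0 :=
  ⟨fun _ => 1, fun h => one_ne_zero (congrFun h ⟨0, hn⟩)⟩

lemma smul_le_iff_quad (hX : X.PosDef) (hY : Y.PosDef) (r : ℝ) :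
    r • X ≤ Y ↔ ∀ v, r * quad X v ≤ quad Y v := by
  rw [le_iff_quad (isHermitian_real_smul hX.1 r) hY.1]
  simp only [quad_smul]

lemma le_smul_iff_quad (hX : X.PosDef) (hY : Y.PosDef) (r : ℝ) :
    X ≤ r • Y ↔ ∀ v, quad X v ≤ r * quad Y v := by
  rw [le_iff_quad hX.1 (isHermitian_real_smul hY.1 r)]
  simp only [quad_smul]

/-- Any two positive definite matrices are comparable up to a positive factor. -/
lemma exists_smul_le (hX : X.PosDef) (hY : Y.PosDef) : ∃ r : ℝ, 0 < r ∧ r • X ≤ Y := by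
  rcases n.eq_zero_or_pos with rfl | hn
  · exact ⟨1, one_pos, (Subsingleton.elim _ _ : (1 : ℝ) • X = Y).le⟩
  have hpos : ∀ {Z : Matrix (Fin n) (Fin n) ℝ}, Z.PosDef →
      ∀ v ∈ Metric.sphere (0 : Fin n → ℝ) 1, 0 < quad Z v :=
    fun hZ v hv => quad_pos hZ (ne_zero_of_mem_sphere hv)
  have hcont : ∀ Z : Matrix (Fin n) (Fin n) ℝ, Continuous (quad Z) := fun Z =>
    continuous_quad.comp (continuous_const.prodMk continuous_id)
  obtain ⟨u, hu⟩ := exists_ne_zero_vec hn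
  obtain ⟨a, -, ha⟩ := exists_sphere_smul hu
  obtain ⟨w, hw, hmin⟩ := (isCompact_sphere (0 : Fin n → ℝ) 1).exists_isMinOn ⟨_, ha⟩
    (((hcont Y).continuousOn).div (hcont X).continuousOn fun v hv => (hpos hX v hv).ne')
  refine ⟨quad Y w / quad X w, div_pos (hpos hY w hw) (hpos hX w hw), ?_⟩
  rw [le_iff_quad (isHermitian_real_smul hX.1 _) hY.1]
  refine quad_le_of_sphere fun v hv => ?_
  rw [quad_smul, ← le_div_iff₀ (hpos hX v hv)]
  exact hmin hv

/-- The admissible factors form a closed set, being an intersection of half-lines; a nonzero vector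
bounds it above, so the supremum is attained. -/
lemma lowerRatio_smul_le_and_pos (hn : 0 < n) (hX : X.PosDef) (hY : Y.PosDef) :
    lowerRatio X Y • Y ≤ X ∧ 0 < lowerRatio X Y := by
  obtain ⟨r, hr, hrX⟩ := exists_smul_le hY hX
  obtain ⟨u, hu⟩ := exists_ne_zero_vec hn
  have hset : {t : ℝ | t • Y ≤ X} = ⋂ v, {t : ℝ | t * quad Y v ≤ quad X v} := by
    ext t
    simp [smul_le_iff_quad hY hX]
  have hbdd : BddAbove {t : ℝ | t • Y ≤ X} := by
    refine ⟨quad X u / quad Y u, fun t ht => ?_⟩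
    rw [le_div_iff₀ (quad_pos hY hu)]
    exact (smul_le_iff_quad hY hX t).1 ht u
  have hclosed : IsClosed {t : ℝ | t • Y ≤ X} := by
    rw [hset]
    exact isClosed_iInter fun v => isClosed_le (by fun_prop) (by fun_prop)
  exact ⟨hclosed.csSup_mem ⟨r, hrX⟩ hbdd, hr.trans_le (le_csSup hbdd hrX)⟩

lemma pos_of_le_smul (hn : 0 < n) (hX : X.PosDef) (hY : Y.PosDef) {t : ℝ} (h : X ≤ t • Y) :
    0 < t := by
  obtain ⟨u, hu⟩ := exists_ne_zero_vec hn
  have h1 := (le_smul_iff_quad hX hY t).1 h u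
  exact pos_of_mul_pos_left ((quad_pos hX hu).trans_le h1) (quad_pos hY hu).le

lemma upperRatio_le (hn : 0 < n) (hX : X.PosDef) (hY : Y.PosDef) {t : ℝ} (h : X ≤ t • Y) :
    upperRatio X Y ≤ t :=
  csInf_le ⟨0, fun _ hs => (pos_of_le_smul hn hX hY hs).le⟩ h

lemma le_upperRatio_smul (hn : 0 < n) (hX : X.PosDef) (hY : Y.PosDef) :
    X ≤ upperRatio X Y • Y := by
  obtain ⟨r, hr, hrX⟩ := exists_smul_le hX hY
  have hset : {t : ℝ | X ≤ t • Y} = ⋂ v, {t : ℝ | quad X v ≤ t * quad Y v} := by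
    ext t
    simp [le_smul_iff_quad hX hY]
  have hclosed : IsClosed {t : ℝ | X ≤ t • Y} := by
    rw [hset]
    exact isClosed_iInter fun v => isClosed_le (by fun_prop) (by fun_prop)
  refine hclosed.csInf_mem ⟨r⁻¹, ?_⟩ ⟨0, fun _ hs => (pos_of_le_smul hn hX hY hs).le⟩
  rw [mem_ofPred_eq, le_smul_iff_quad hX hY]
  intro v
  have := (smul_le_iff_quad hX hY r).1 hrX v
  rwa [← div_eq_inv_mul, le_div_iff₀ hr, mul_comm]

lemma upperRatio_pos (hn : 0 < n) (hX : X.PosDef) (hY : Y.PosDef) : 0 < upperRatio X Y :=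
  pos_of_le_smul hn hX hY (le_upperRatio_smul hn hX hY)

lemma thompson_comm (X Y : Matrix (Fin n) (Fin n) ℝ) : thompson X Y = thompson Y X := by
  rw [thompson, thompson, max_comm]

lemma thompson_le (hn : 0 < n) (hX : X.PosDef) (hY : Y.PosDef) {d : ℝ}
    (h1 : X ≤ Real.exp d • Y) (h2 : Y ≤ Real.exp d • X) : thompson X Y ≤ d := by
  rw [thompson, Real.log_le_iff_le_exp (lt_max_of_lt_left (upperRatio_pos hn hX hY))]
  exact max_le (upperRatio_le hn hX hY h1) (upperRatio_le hn hY hX h2)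

lemma le_exp_thompson_smul (hn : 0 < n) (hX : X.PosDef) (hY : Y.PosDef) :
    X ≤ Real.exp (thompson X Y) • Y := by
  rw [thompson, Real.exp_log (lt_max_of_lt_left (upperRatio_pos hn hX hY)),
    le_smul_iff_quad hX hY]
  intro v
  refine ((le_smul_iff_quad hX hY _).1 (le_upperRatio_smul hn hX hY) v).trans ?_
  exact mul_le_mul_of_nonneg_right (le_max_left _ _) ((posSemidef_iff_quad hY.1).1 hY.posSemidef v)

/-- A negative value `d` would give `X ≤ e^d Y ≤ e^{2d} X` with `e^{2d} < 1`. -/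
lemma thompson_nonneg (hn : 0 < n) (hX : X.PosDef) (hY : Y.PosDef) : 0 ≤ thompson X Y := by
  by_contra! h
  obtain ⟨u, hu⟩ := exists_ne_zero_vec hn
  have h1 := (le_smul_iff_quad hX hY _).1 (le_exp_thompson_smul hn hX hY) u
  have h2 := (le_smul_iff_quad hY hX _).1 (le_exp_thompson_smul hn hY hX) u
  rw [thompson_comm] at h2
  have h3 := quad_pos hX hu
  have h4 := quad_pos hY hu
  have h5 := (Real.exp_lt_exp.2 h).trans_eq Real.exp_zero
  nlinarith

lemma thompson_pos (hn : 0 < n) (hX : X.PosDef) (hY : Y.PosDef) (hne : X ≠ Y) :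
    0 < thompson X Y := by
  refine (thompson_nonneg hn hX hY).lt_of_ne fun h => hne ?_
  have h1 := le_exp_thompson_smul hn hX hY
  have h2 := le_exp_thompson_smul hn hY hX
  rw [thompson_comm] at h2
  rw [← h, Real.exp_zero, one_smul] at h1 h2
  exact le_antisymm h1 h2

end ThompsonMetric

/-! ### The Riccati field as a minimum over feedback gains. -/

namespace Coeffs

variable {n k : ℕ} (c : Coeffs n k)

/-- The linear part of the closed-loop vector field for the feedback gain `K`. -/
def lyap (K : Matrix (Fin k) (Fin n) ℝ) (P : Matrix (Fin n) (Fin n) ℝ) :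
    Matrix (Fin n) (Fin n) ℝ :=
  (c.A + c.B * K)ᵀ * P + P * (c.A + c.B * K) + (c.C + c.D * K)ᵀ * P * (c.C + c.D * K)

/-- The running cost of the feedback gain `K`. -/
def cost (K : Matrix (Fin k) (Fin n) ℝ) : Matrix (Fin n) (Fin n) ℝ :=
  c.Q + c.Lᵀ * K + Kᵀ * c.L + Kᵀ * c.R * K

/-- The optimal feedback gain. -/
noncomputable def gain (P : Matrix (Fin n) (Fin n) ℝ) : Matrix (Fin k) (Fin n) ℝ :=
  -((c.R + c.Dᵀ * P * c.D)⁻¹ * (c.Bᵀ * P + c.Dᵀ * P * c.C + c.L))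

lemma complete_square {S : Matrix (Fin k) (Fin k) ℝ} (hS : S.PosDef)
    (N K : Matrix (Fin k) (Fin n) ℝ) :
    (K + S⁻¹ * N)ᵀ * S * (K + S⁻¹ * N) = Kᵀ * S * K + Kᵀ * N + Nᵀ * K + Nᵀ * S⁻¹ * N := by
  have hdet : IsUnit S.det := (isUnit_iff_isUnit_det S).1 hS.isUnit
  have hsym : (S⁻¹)ᵀ = S⁻¹ := by
    simpa [IsHermitian, conjTranspose_eq_transpose_of_trivial] using hS.inv.1
  have h1 : (K + S⁻¹ * N)ᵀ * S = Kᵀ * S + Nᵀ := by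
    rw [transpose_add, transpose_mul, hsym, Matrix.add_mul, Matrix.mul_assoc Nᵀ, nonsing_inv_mul _ hdet,
      Matrix.mul_one]
  rw [h1, Matrix.mul_add, Matrix.add_mul, Matrix.add_mul, ← Matrix.mul_assoc (Kᵀ * S),
    Matrix.mul_assoc Kᵀ S S⁻¹, mul_nonsing_inv _ hdet, Matrix.mul_one, Matrix.mul_assoc Nᵀ S⁻¹ N]
  abel

lemma posDef_R (hc : c.weight.PosDef) : c.R.PosDef := by
  have := hc.submatrix (e := (Sum.inr : Fin k → Fin n ⊕ Fin k)) Sum.inr_injective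
  convert this using 1
  ext i j
  rfl

lemma isHermitian_Q (hc : c.weight.PosDef) : c.Q.IsHermitian := by
  have := hc.submatrix (e := (Sum.inl : Fin n → Fin n ⊕ Fin k)) Sum.inl_injective
  convert this.1 using 1
  ext i j
  rfl

/-- Evaluate the weight at `(v, -R⁻¹Lv)`, for which the lower block of the image is zero. -/
lemma posDef_schur (hc : c.weight.PosDef) : (c.Q - c.Lᵀ * c.R⁻¹ * c.L).PosDef := by
  have hR := c.posDef_R hc
  have hinv : (c.R⁻¹).IsHermitian := hR.inv.1
  have hherm : (c.Q - c.Lᵀ * c.R⁻¹ * c.L).IsHermitian := by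
    refine (c.isHermitian_Q hc).sub ?_
    have := isHermitian_conjTranspose_mul_mul c.L hinv
    rwa [conjTranspose_eq_transpose_of_trivial] at this
  refine .of_dotProduct_mulVec_pos hherm fun v hv => ?_
  have hx : Sum.elim v (-((c.R⁻¹ * c.L) *ᵥ v)) ≠ 0 := fun h =>
    hv (funext fun i => congrFun h (Sum.inl i))
  have hdet : IsUnit c.R.det := (isUnit_iff_isUnit_det _).1 hR.isUnit
  have := hc.dotProduct_mulVec_pos hx
  have hbot : c.L *ᵥ v + c.R *ᵥ (-((c.R⁻¹ * c.L) *ᵥ v)) = 0 := by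
    rw [mulVec_neg, mulVec_mulVec, ← Matrix.mul_assoc, mul_nonsing_inv _ hdet, Matrix.one_mul,
      add_neg_cancel]
  rw [weight, fromBlocks_mulVec] at this
  simp only [Sum.elim_comp_inl, Sum.elim_comp_inr, hbot, star_trivial,
    sumElim_dotProduct_sumElim, dotProduct_zero, add_zero] at this
  simpa [sub_mulVec, mulVec_neg, Matrix.mul_assoc, ← sub_eq_add_neg] using this

lemma posDef_S (hc : c.weight.PosDef) {P : Matrix (Fin n) (Fin n) ℝ} (hP : P.PosSemidef) :
    (c.R + c.Dᵀ * P * c.D).PosDef := by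
  refine (c.posDef_R hc).add_posSemidef ?_
  simpa [conjTranspose_eq_transpose_of_trivial] using hP.conjTranspose_mul_mul_same c.D

/-- The deviation from the optimal gain enters as a square weighted by `R + DᵀPD > 0`; this is the
source of the minimum property. -/
lemma lyap_add_cost (hc : c.weight.PosDef) {P : Matrix (Fin n) (Fin n) ℝ} (hP : P.PosSemidef)
    (K : Matrix (Fin k) (Fin n) ℝ) :
    c.lyap K P + c.cost K =
      c.phi P + (K - c.gain P)ᵀ * (c.R + c.Dᵀ * P * c.D) * (K - c.gain P) := by
  have hPt : Pᵀ = P := by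
    simpa [IsHermitian, conjTranspose_eq_transpose_of_trivial] using hP.1
  rw [gain, sub_neg_eq_add, complete_square (c.posDef_S hc hP)]
  simp only [lyap, cost, phi, transpose_add, transpose_mul, transpose_transpose, hPt,
    Matrix.mul_add, Matrix.add_mul, Matrix.mul_assoc]
  abel

lemma phi_eq (hc : c.weight.PosDef) {P : Matrix (Fin n) (Fin n) ℝ} (hP : P.PosSemidef) :
    c.phi P = c.lyap (c.gain P) P + c.cost (c.gain P) := by
  rw [lyap_add_cost c hc hP]
  simp

lemma phi_le (hc : c.weight.PosDef) {P : Matrix (Fin n) (Fin n) ℝ} (hP : P.PosSemidef)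
    (K : Matrix (Fin k) (Fin n) ℝ) : c.phi P ≤ c.lyap K P + c.cost K := by
  rw [lyap_add_cost c hc hP, le_iff, add_sub_cancel_left]
  simpa [conjTranspose_eq_transpose_of_trivial] using
    (c.posDef_S hc hP).posSemidef.conjTranspose_mul_mul_same (K - c.gain P)

/-- The difference is the square of `K + R⁻¹L` weighted by `R`, so the lower bound is independent of
the gain. -/
lemma schur_le_cost (hc : c.weight.PosDef) (K : Matrix (Fin k) (Fin n) ℝ) :
    c.Q - c.Lᵀ * c.R⁻¹ * c.L ≤ c.cost K := by
  have hR := c.posDef_R hc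
  have h := hR.posSemidef.conjTranspose_mul_mul_same (K + c.R⁻¹ * c.L)
  rw [conjTranspose_eq_transpose_of_trivial, complete_square hR] at h
  rw [le_iff]
  have hsub : c.cost K - (c.Q - c.Lᵀ * c.R⁻¹ * c.L) =
      Kᵀ * c.R * K + Kᵀ * c.L + c.Lᵀ * K + c.Lᵀ * c.R⁻¹ * c.L := by
    rw [cost]
    abel
  rwa [hsub]

lemma continuousOn_gain (hc : c.weight.PosDef) : ContinuousOn c.gain (posDefCone n) := by
  have h1 : Continuous fun P : Matrix (Fin n) (Fin n) ℝ => c.R + c.Dᵀ * P * c.D := by fun_prop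
  have h2 : Continuous fun P : Matrix (Fin n) (Fin n) ℝ => c.Bᵀ * P + c.Dᵀ * P * c.C + c.L := by
    fun_prop
  have hS : ContinuousOn (fun P => (c.R + c.Dᵀ * P * c.D)⁻¹) (posDefCone n) := by
    simp only [Matrix.inv_def, Ring.inverse_eq_inv']
    refine ContinuousOn.smul (ContinuousOn.inv₀ h1.matrix_det.continuousOn fun P hP => ?_)
      h1.matrix_adjugate.continuousOn
    exact (c.posDef_S hc hP.posSemidef).det_pos.ne'
  unfold gain
  refine ContinuousOn.neg fun P hP => ?_
  exact ((continuous_fst.matrix_mul continuous_snd).tendsto _).comp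
    ((hS P hP).prodMk_nhds h2.continuousWithinAt)

end Coeffs

end GRDE

namespace GRDE

open Set Filter Topology Matrix

/-! ### Contraction, uniqueness and bounds along trajectories. -/

namespace Coeffs

variable {n k : ℕ} (c : Coeffs n k)

lemma lyap_sub (K : Matrix (Fin k) (Fin n) ℝ) (P P' : Matrix (Fin n) (Fin n) ℝ) :
    c.lyap K (P - P') = c.lyap K P - c.lyap K P' := by
  simp only [lyap, Matrix.mul_sub, Matrix.sub_mul]
  abel

lemma lyap_smul (K : Matrix (Fin k) (Fin n) ℝ) (r : ℝ) (P : Matrix (Fin n) (Fin n) ℝ) :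
    c.lyap K (r • P) = r • c.lyap K P := by
  simp only [lyap, Matrix.mul_smul, Matrix.smul_mul, smul_add]

lemma isHermitian_lyap_one (K : Matrix (Fin k) (Fin n) ℝ) : (c.lyap K 1).IsHermitian := by
  rw [IsHermitian, conjTranspose_eq_transpose_of_trivial, lyap]
  simp only [transpose_add, transpose_mul, transpose_transpose, Matrix.mul_one, Matrix.one_mul]
  abel

/-- `X` solves the Riccati equation on `[0,b]` with positive definite values. -/
def IsTrajectory (b : ℝ) (X : ℝ → Matrix (Fin n) (Fin n) ℝ) : Prop :=
  ∀ s ∈ Icc 0 b, (X s).PosDef ∧ HasDerivWithinAt X (c.phi (X s)) (Ici 0) s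

variable {c}

lemma IsTrajectory.continuousOn {b : ℝ} {X : ℝ → Matrix (Fin n) (Fin n) ℝ}
    (hX : c.IsTrajectory b X) : ContinuousOn X (Icc 0 b) := fun s hs =>
  (continuousWithinAt_of_hasDerivWithinAt (hX s hs).2).mono fun _ hr => hr.1

lemma IsTrajectory.mono {a b : ℝ} {X : ℝ → Matrix (Fin n) (Fin n) ℝ}
    (hX : c.IsTrajectory b X) (hab : a ≤ b) : c.IsTrajectory a X := fun s hs =>
  hX s ⟨hs.1, hs.2.trans hab⟩

/-- This is `1 + x ≤ e^x` multiplied by `e^{-x}`; it lets the surplus `(1 - μ) cost` pay for the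
growth of `μ`. -/
lemma mul_exp_neg_le (x : ℝ) : x * Real.exp (-x) ≤ 1 - Real.exp (-x) := by
  have h1 := Real.add_one_le_exp x
  have h2 := mul_le_mul_of_nonneg_right h1 (Real.exp_pos (-x)).le
  rw [← Real.exp_add, add_neg_cancel, Real.exp_zero] at h2
  linarith

/-- Along trajectories the Loewner ratio `exp d` decays to `exp (exp (-α b) d)`, provided the
first trajectory `X₁` satisfies `α X₁ ≤ Q - LᵀR⁻¹L`. -/
theorem IsTrajectory.le_exp_smul (hc : c.weight.PosDef) {b α d : ℝ} (hb : 0 ≤ b) (hα : 0 ≤ α)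
    (hd : 0 ≤ d) {X₁ X₂ : ℝ → Matrix (Fin n) (Fin n) ℝ}
    (h₁ : c.IsTrajectory b X₁) (h₂ : c.IsTrajectory b X₂)
    (hW : ∀ s ∈ Icc 0 b, α • X₁ s ≤ c.Q - c.Lᵀ * c.R⁻¹ * c.L)
    (h0 : X₁ 0 ≤ Real.exp d • X₂ 0) :
    X₁ b ≤ Real.exp (Real.exp (-α * b) * d) • X₂ b := by
  set x : ℝ → ℝ := fun s => Real.exp (-α * s) * d with hx
  have hxnn : ∀ s, 0 ≤ x s := fun s => by positivity
  set μ : ℝ → ℝ := fun s => Real.exp (-x s) with hμ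
  have hxd : ∀ s, HasDerivAt x (-α * x s) s := fun s => by
    refine ((((hasDerivAt_id' s).const_mul (-α)).exp).mul_const d).congr_deriv ?_
    simp only [hx]
    ring
  have hμd : ∀ s, HasDerivAt μ (α * x s * μ s) s := fun s => by
    refine (hxd s).neg.exp.congr_deriv ?_
    simp only [hμ, Pi.neg_apply]
    ring
  have hgain : ContinuousOn (fun s => c.gain (X₂ s)) (Icc 0 b) :=
    (c.continuousOn_gain hc).comp h₂.continuousOn fun s hs => (h₂ s hs).1
  have hlc : ContinuousOn (fun s => c.lyap (c.gain (X₂ s)) 1) (Icc 0 b) := by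
    have : Continuous fun K => c.lyap K 1 := by unfold lyap; fun_prop
    exact this.comp_continuousOn hgain
  obtain ⟨C, -, hC⟩ := exists_le_smul_one isCompact_Icc hlc
    fun s _ => c.isHermitian_lyap_one (c.gain (X₂ s))
  have key : 0 ≤ X₂ b - μ b • X₁ b := by
    -- The gain is the optimal one for `X₂`: equality holds for `X₂`, and the inequality for `X₁`
    -- enters with the favourable sign.
    refine nonneg_of_lyapunov_le_deriv (Δ := fun s => X₂ s - μ s • X₁ s)
      (Δ' := fun s => c.phi (X₂ s) - ((α * x s * μ s) • X₁ s + μ s • c.phi (X₁ s)))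
      (F := fun s => c.A + c.B * c.gain (X₂ s)) (G := fun s => c.C + c.D * c.gain (X₂ s))
      hb ?_ ?_ ?_ ?_ hC ?_
    · exact fun s hs => (h₂ s hs).1.1.sub (isHermitian_real_smul (h₁ s hs).1.1 _)
    · have hμc : ContinuousOn μ (Icc 0 b) := fun s _ => (hμd s).continuousAt.continuousWithinAt
      exact h₂.continuousOn.sub (hμc.smul h₁.continuousOn)
    · intro s hs v
      simp only [quad_sub, quad_add, quad_smul]
      exact (hasDerivWithinAt_quad (h₂ s hs).2 v).sub
        ((hμd s).hasDerivWithinAt.mul (hasDerivWithinAt_quad (h₁ s hs).2 v))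
    · intro s hs v
      change quad (c.lyap (c.gain (X₂ s)) (X₂ s - μ s • X₁ s)) v ≤ _
      rw [lyap_sub, lyap_smul]
      have e1 := quad_le_quad (c.phi_le hc (h₁ s hs).1.posSemidef (c.gain (X₂ s))) v
      have e2 := quad_le_quad (c.schur_le_cost hc (c.gain (X₂ s))) v
      have e3 := quad_le_quad (hW s hs) v
      have e4 := (posSemidef_iff_quad (h₁ s hs).1.1).1 (h₁ s hs).1.posSemidef v
      have e5 : x s * μ s ≤ 1 - μ s := mul_exp_neg_le (x s)
      have e6 : 0 < μ s := Real.exp_pos _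
      have e7 := hxnn s
      rw [c.phi_eq hc (h₂ s hs).1.posSemidef]
      rw [quad_smul] at e3
      simp only [quad_sub, quad_add, quad_smul] at e1 ⊢
      have e8 : 0 ≤ 1 - μ s := le_trans (by positivity) e5
      have e9 := mul_le_mul_of_nonneg_left e1 e6.le
      have e10 := mul_le_mul_of_nonneg_left (e3.trans e2) e8
      have e11 := mul_le_mul_of_nonneg_right e5 (mul_nonneg hα e4)
      nlinarith
    · simp only [hμ, hx, mul_zero, Real.exp_zero, one_mul, sub_nonneg]
      have p1 := (h₁ 0 ⟨le_rfl, hb⟩).1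
      have p2 := (h₂ 0 ⟨le_rfl, hb⟩).1
      rw [smul_le_iff_quad p1 p2]
      intro v
      have := (le_smul_iff_quad p1 p2 _).1 h0 v
      rwa [Real.exp_neg, inv_mul_le_iff₀ (Real.exp_pos _)]
  have p1 := (h₁ b ⟨hb, le_rfl⟩).1
  have p2 := (h₂ b ⟨hb, le_rfl⟩).1
  rw [le_smul_iff_quad p1 p2]
  intro v
  have := (smul_le_iff_quad p1 p2 _).1 (sub_nonneg.1 key) v
  simp only [hμ] at this
  rwa [Real.exp_neg, inv_mul_le_iff₀ (Real.exp_pos _)] at this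

theorem IsTrajectory.thompson_le (hn : 0 < n) (hc : c.weight.PosDef) {b α : ℝ} (hb : 0 ≤ b)
    (hα : 0 ≤ α) {X₁ X₂ : ℝ → Matrix (Fin n) (Fin n) ℝ}
    (h₁ : c.IsTrajectory b X₁) (h₂ : c.IsTrajectory b X₂)
    (hW₁ : ∀ s ∈ Icc 0 b, α • X₁ s ≤ c.Q - c.Lᵀ * c.R⁻¹ * c.L)
    (hW₂ : ∀ s ∈ Icc 0 b, α • X₂ s ≤ c.Q - c.Lᵀ * c.R⁻¹ * c.L) :
    thompson (X₁ b) (X₂ b) ≤ Real.exp (-α * b) * thompson (X₁ 0) (X₂ 0) := by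
  have p1 := (h₁ 0 ⟨le_rfl, hb⟩).1
  have p2 := (h₂ 0 ⟨le_rfl, hb⟩).1
  have hd := thompson_nonneg hn p1 p2
  refine GRDE.thompson_le hn (h₁ b ⟨hb, le_rfl⟩).1 (h₂ b ⟨hb, le_rfl⟩).1 ?_ ?_
  · exact h₁.le_exp_smul hc hb hα hd h₂ hW₁ (le_exp_thompson_smul hn p1 p2)
  · refine h₂.le_exp_smul hc hb hα hd h₁ hW₂ ?_
    rw [thompson_comm]
    exact le_exp_thompson_smul hn p2 p1

/-- Monotonicity is the case `α = 0`, `d = 0`, where the rate condition reduces to `0 ≤ W`. -/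
lemma IsTrajectory.le_of_le (hc : c.weight.PosDef) {b : ℝ} (hb : 0 ≤ b)
    {X₁ X₂ : ℝ → Matrix (Fin n) (Fin n) ℝ}
    (h₁ : c.IsTrajectory b X₁) (h₂ : c.IsTrajectory b X₂) (h0 : X₁ 0 ≤ X₂ 0) : X₁ b ≤ X₂ b := by
  have := h₁.le_exp_smul hc hb le_rfl le_rfl h₂ (fun s _ => by
    rw [zero_smul]
    exact (c.posDef_schur hc).posSemidef.nonneg) (by simpa using h0)
  simpa using this

lemma IsTrajectory.unique (hc : c.weight.PosDef) {b : ℝ} (hb : 0 ≤ b)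
    {X₁ X₂ : ℝ → Matrix (Fin n) (Fin n) ℝ}
    (h₁ : c.IsTrajectory b X₁) (h₂ : c.IsTrajectory b X₂) (h0 : X₁ 0 = X₂ 0) : X₁ b = X₂ b :=
  le_antisymm (h₁.le_of_le hc hb h₂ h0.le) (h₂.le_of_le hc hb h₁ h0.ge)

variable (c) in
/-- On bounded time intervals, trajectories are bounded above in terms of their initial values. -/
theorem exists_uniform_bound (hc : c.weight.PosDef) (T β : ℝ) :
    ∃ γ : ℝ, 0 < γ ∧ ∀ b ≤ T, ∀ X, c.IsTrajectory b X →
      X 0 ≤ β • (1 : Matrix (Fin n) (Fin n) ℝ) →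
      ∀ s ∈ Icc 0 b, X s ≤ γ • (1 : Matrix (Fin n) (Fin n) ℝ) := by
  obtain ⟨a, ha, hlyap⟩ := exists_le_smul_one (H := fun _ : ℝ => c.lyap 0 1)
    (isCompact_singleton (x := 0)) continuousOn_const fun _ _ => c.isHermitian_lyap_one 0
  obtain ⟨q, hq, hQ⟩ := exists_le_smul_one (H := fun _ : ℝ => c.Q)
    (isCompact_singleton (x := 0)) continuousOn_const fun _ _ => c.isHermitian_Q hc
  replace hlyap := hlyap 0 rfl
  replace hQ := hQ 0 rfl
  -- Taking `β' ≥ 1` ensures `z ≥ 1` below, so that `z' = (a + q) z ≥ a z + q` dominates the field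
  -- for the zero gain.
  set β' := max β 1 with hβ'
  have hβpos : 1 ≤ β' := le_max_right _ _
  have hone : ∀ r : ℝ, (r • (1 : Matrix (Fin n) (Fin n) ℝ)).IsHermitian := fun r =>
    isHermitian_real_smul isHermitian_one r
  have hvv : ∀ v : Fin n → ℝ, 0 ≤ v ⬝ᵥ v := fun v =>
    Finset.sum_nonneg fun i _ => mul_self_nonneg _
  have hsmul : ∀ {r r' : ℝ}, r ≤ r' →
      r • (1 : Matrix (Fin n) (Fin n) ℝ) ≤ r' • (1 : Matrix (Fin n) (Fin n) ℝ) := by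
    intro r r' h
    rw [le_iff_quad (hone r) (hone r')]
    intro v
    rw [quad_smul, quad_smul, quad_one]
    exact mul_le_mul_of_nonneg_right h (hvv v)
  refine ⟨β' * Real.exp ((a + q) * T), by positivity, fun b hbT X hX hX0 s hs => ?_⟩
  set z : ℝ → ℝ := fun r => β' * Real.exp ((a + q) * r) with hz
  have hzd : ∀ r, HasDerivAt z ((a + q) * z r) r := fun r => by
    refine ((((hasDerivAt_id' r).const_mul (a + q)).exp).const_mul β').congr_deriv ?_
    simp only [hz]
    ring
  have hXs : c.IsTrajectory s X := hX.mono hs.2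
  have key : 0 ≤ z s • (1 : Matrix (Fin n) (Fin n) ℝ) - X s := by
    refine nonneg_of_lyapunov_le_deriv (Δ := fun r => z r • (1 : Matrix (Fin n) (Fin n) ℝ) - X r)
      (Δ' := fun r => ((a + q) * z r) • (1 : Matrix (Fin n) (Fin n) ℝ) - c.phi (X r))
      (F := fun _ => c.A + c.B * 0) (G := fun _ => c.C + c.D * 0)
      hs.1 ?_ ?_ ?_ ?_ (fun _ _ => hlyap) ?_
    · exact fun r hr => (hone _).sub (hXs r hr).1.1
    · have hzc : ContinuousOn z (Icc 0 s) := fun r _ => (hzd r).continuousAt.continuousWithinAt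
      exact (hzc.smul continuousOn_const).sub hXs.continuousOn
    · intro r hr v
      simp only [quad_sub, quad_smul]
      exact ((hzd r).hasDerivWithinAt.mul_const _).sub (hasDerivWithinAt_quad (hXs r hr).2 v)
    · intro r hr v
      change quad (c.lyap 0 (z r • (1 : Matrix (Fin n) (Fin n) ℝ) - X r)) v ≤ _
      rw [lyap_sub, lyap_smul]
      have e1 := quad_le_quad (c.phi_le hc (hXs r hr).1.posSemidef 0) v
      have e2 := quad_le_quad hlyap v
      have e3 := quad_le_quad hQ v
      have hcost : c.cost 0 = c.Q := by simp [cost]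
      have hz1 : 1 ≤ z r := by
        have : 1 ≤ Real.exp ((a + q) * r) := Real.one_le_exp (mul_nonneg (by positivity) hr.1)
        exact one_le_mul_of_one_le_of_one_le hβpos this
      rw [hcost, quad_add] at e1
      simp only [quad_sub, quad_smul, quad_one] at e2 e3 ⊢
      have e4 := mul_le_mul_of_nonneg_left e2 (zero_le_one.trans hz1)
      have e5 := mul_le_mul_of_nonneg_right hz1 (mul_nonneg hq.le (hvv v))
      nlinarith
    · simp only [hz, mul_zero, Real.exp_zero, mul_one, sub_nonneg]
      exact hX0.trans (hsmul (le_max_left _ _))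
  refine (sub_nonneg.1 key).trans (hsmul ?_)
  simp only [hz]
  gcongr
  exact hs.2.trans hbT

/-! ### From the flow to trajectories, and the main theorem. -/

lemma isTrajectory_of_isSolution {P : Matrix (Fin n) (Fin n) ℝ} {b : EReal} {t : ℝ}
    {X : ℝ → Matrix (Fin n) (Fin n) ℝ} (hX : IsSolution c.phi (posDefCone n) P b X)
    (ht : (t : EReal) < b) : c.IsTrajectory t X := fun s hs => by
  have hsb : (s : EReal) < b := (EReal.coe_le_coe_iff.2 hs.2).trans_lt ht
  exact ⟨hX.2.2.1 s hs.1 hsb, hX.2.2.2.1 s hs.1 hsb⟩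

/-- Before its exit time from `U`, the flow is given by a single trajectory with values in `U`. -/
theorem exists_trajectory_of_lt_exit (hc : c.weight.PosDef) {U : Set (Matrix (Fin n) (Fin n) ℝ)}
    {P : Matrix (Fin n) (Fin n) ℝ} {t : ℝ} (ht : (t : EReal) < c.exit U P) :
    ∃ X, c.IsTrajectory t X ∧ X 0 = P ∧ (0 ≤ t → c.M t P = X t) ∧ ∀ s ∈ Icc 0 t, X s ∈ U := by
  obtain ⟨_, ⟨b, rfl, -, hb, hU⟩, htb⟩ := lt_sSup_iff.1 ht
  obtain ⟨e, ⟨X, hX⟩, hbe⟩ := lt_sSup_iff.1 hb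
  have hM : ∀ s ∈ Icc 0 t, c.M s P = X s := by
    intro s hs
    have hse : (s : EReal) < e :=
      ((EReal.coe_le_coe_iff.2 hs.2).trans_lt htb).trans hbe
    have hex : ∃ X : ℝ → Matrix (Fin n) (Fin n) ℝ, ∃ b : EReal,
        (s : EReal) < b ∧ IsSolution c.phi (posDefCone n) P b X := ⟨X, e, hse, hX⟩
    rw [M, flow, dif_pos hex]
    -- The flow picks a solution separately for each time; uniqueness identifies its value with that
    -- of `X`.
    obtain ⟨b', hsb', hY⟩ := Classical.choose_spec hex
    exact (isTrajectory_of_isSolution hY hsb').unique hc hs.1 (isTrajectory_of_isSolution hX hse)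
      (hY.2.1.trans hX.2.1.symm)
  refine ⟨X, isTrajectory_of_isSolution hX (htb.trans hbe), hX.2.1,
    fun h => hM t ⟨h, le_rfl⟩, fun s hs => ?_⟩
  rw [← hM s hs]
  exact hU s hs.1 (hs.2.trans_lt (EReal.coe_lt_coe_iff.1 htb))

end Coeffs

lemma smul_le_of_le_of_smul_le {n : ℕ} {X Y W : Matrix (Fin n) (Fin n) ℝ} {r : ℝ} (hr : 0 ≤ r)
    (hXY : X ≤ Y) (hY : r • Y ≤ W) : r • X ≤ W := by
  refine le_trans ?_ hY
  rw [le_iff, ← smul_sub]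
  exact hXY.smul hr

end GRDE

theorem mainTheorem2 {n k : ℕ} (hn : 0 < n) (c : GRDE.Coeffs n k) (hc : c.weight.PosDef) :
    -- explicit rate on scaling-invariant open sets bounded above by `P₀`
    (∀ (U : Set (Matrix (Fin n) (Fin n) ℝ)) (P₀ : Matrix (Fin n) (Fin n) ℝ),
      GRDE.IsOpenInSym U →
      (∀ r : ℝ, 0 < r → r ≤ 1 → ∀ P ∈ U, r • P ∈ U) →
      P₀.PosDef →
      (∀ P ∈ U, P.PosDef ∧ P ≤ P₀) →
      0 < GRDE.lowerRatio (c.Q - c.L.transpose * c.R⁻¹ * c.L) P₀ ∧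
      ∀ P₁ ∈ U, ∀ P₂ ∈ U, ∀ t : ℝ, 0 ≤ t → (t : EReal) < min (c.exit U P₁) (c.exit U P₂) →
        GRDE.thompson (c.M t P₁) (c.M t P₂) ≤
          Real.exp (-(GRDE.lowerRatio (c.Q - c.L.transpose * c.R⁻¹ * c.L) P₀) * t)
            * GRDE.thompson P₁ P₂) ∧
    -- strict contraction on the cone of positive definite matrices
    (∀ P₁ P₂ : Matrix (Fin n) (Fin n) ℝ, P₁.PosDef → P₂.PosDef → P₁ ≠ P₂ →
      ∀ t : ℝ, 0 < t →
        (t : EReal) < min (c.exit (GRDE.posDefCone n) P₁) (c.exit (GRDE.posDefCone n) P₂) →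
        GRDE.thompson (c.M t P₁) (c.M t P₂) < GRDE.thompson P₁ P₂) ∧
    -- uniformity on sets bounded above, as long as the trajectories stay in the set
    (∀ S : Set (Matrix (Fin n) (Fin n) ℝ), S ⊆ GRDE.posDefCone n → BddAbove S →
      ∃ α : ℝ, 0 < α ∧ ∀ P₁ ∈ S, ∀ P₂ ∈ S, ∀ t : ℝ, 0 ≤ t →
        (t : EReal) < min (c.exit S P₁) (c.exit S P₂) →
        GRDE.thompson (c.M t P₁) (c.M t P₂) ≤ Real.exp (-α * t) * GRDE.thompson P₁ P₂) ∧
    -- uniformity over initial values in a set bounded above, on any bounded time interval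
    (∀ S : Set (Matrix (Fin n) (Fin n) ℝ), S ⊆ GRDE.posDefCone n → BddAbove S →
      ∀ T : ℝ, 0 < T →
      ∃ α : ℝ, 0 < α ∧ ∀ P₁ ∈ S, ∀ P₂ ∈ S, ∀ t : ℝ, 0 ≤ t → t ≤ T →
        (t : EReal) < min (c.exit (GRDE.posDefCone n) P₁) (c.exit (GRDE.posDefCone n) P₂) →
        GRDE.thompson (c.M t P₁) (c.M t P₂) ≤ Real.exp (-α * t) * GRDE.thompson P₁ P₂) := by
  have hW := c.posDef_schur hc
  -- a bound for the initial values in a bounded set by a multiple of the identity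
  have hS1 : ∀ S : Set (Matrix (Fin n) (Fin n) ℝ), S ⊆ GRDE.posDefCone n → BddAbove S →
      ∃ β : ℝ, 0 < β ∧ ∀ P ∈ S, P ≤ β • (1 : Matrix (Fin n) (Fin n) ℝ) := by
    rintro S hS ⟨B, hB⟩
    rcases S.eq_empty_or_nonempty with rfl | ⟨P, hP⟩
    · exact ⟨1, one_pos, by simp⟩
    -- An upper bound `B` is not assumed symmetric, but `B = P + (B - P)` is a sum of symmetric
    -- matrices.
    · have hBh : B.IsHermitian := by
        have := (hS hP).1.add (hB hP).1
        rwa [add_sub_cancel] at this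
      obtain ⟨β, hβ, h⟩ := GRDE.exists_le_smul_one (H := fun _ : ℝ => B)
        (isCompact_singleton (x := 0)) continuousOn_const fun _ _ => hBh
      exact ⟨β, hβ, fun P hP => (hB hP).trans (h 0 rfl)⟩
  -- a positive rate for trajectories below a multiple of the identity
  have hrate : ∀ γ : ℝ, 0 < γ → ∃ α : ℝ, 0 < α ∧
      α • (γ • (1 : Matrix (Fin n) (Fin n) ℝ)) ≤ c.Q - c.L.transpose * c.R⁻¹ * c.L :=
    fun γ hγ => GRDE.exists_smul_le (Matrix.PosDef.one.smul hγ) hW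
  -- Common reduction: a matrix `Z` dominating both trajectories, with `α • Z` below the Schur
  -- complement, gives the rate `α`.
  have main : ∀ (V : Set (Matrix (Fin n) (Fin n) ℝ)) (P₁ P₂ Z : Matrix (Fin n) (Fin n) ℝ)
      (α t : ℝ), 0 ≤ α → 0 ≤ t → α • Z ≤ c.Q - c.L.transpose * c.R⁻¹ * c.L →
      (t : EReal) < min (c.exit V P₁) (c.exit V P₂) →
      (∀ X, c.IsTrajectory t X → (X 0 = P₁ ∨ X 0 = P₂) → (∀ s ∈ Set.Icc 0 t, X s ∈ V) →
        ∀ s ∈ Set.Icc 0 t, X s ≤ Z) →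
      GRDE.thompson (c.M t P₁) (c.M t P₂) ≤ Real.exp (-α * t) * GRDE.thompson P₁ P₂ := by
    intro V P₁ P₂ Z α t hα ht hZ hlt hbd
    obtain ⟨X₁, h₁, rfl, hM₁, hV₁⟩ :=
      GRDE.Coeffs.exists_trajectory_of_lt_exit hc (hlt.trans_le (min_le_left _ _))
    obtain ⟨X₂, h₂, rfl, hM₂, hV₂⟩ :=
      GRDE.Coeffs.exists_trajectory_of_lt_exit hc (hlt.trans_le (min_le_right _ _))
    rw [hM₁ ht, hM₂ ht]
    exact h₁.thompson_le hn hc ht hα h₂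
      (fun s hs => GRDE.smul_le_of_le_of_smul_le hα (hbd X₁ h₁ (.inl rfl) hV₁ s hs) hZ)
      (fun s hs => GRDE.smul_le_of_le_of_smul_le hα (hbd X₂ h₂ (.inr rfl) hV₂ s hs) hZ)
  refine ⟨?_, ?_, ?_, ?_⟩
  · intro U P₀ _ _ hP₀ hU
    obtain ⟨hle, hpos⟩ := GRDE.lowerRatio_smul_le_and_pos hn hW hP₀
    exact ⟨hpos, fun P₁ _ P₂ _ t ht hlt => main U P₁ P₂ P₀ _ t hpos.le ht hle hlt
      fun X _ _ hXU s hs => (hU _ (hXU s hs)).2⟩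
  · intro P₁ P₂ hP₁ hP₂ hne t ht hlt
    obtain ⟨β, -, hβS⟩ := hS1 {P₁, P₂} (by rintro P (rfl | rfl) <;> assumption)
      ⟨P₁ + P₂, by
        rintro P (rfl | rfl)
        · exact le_add_of_nonneg_right hP₂.posSemidef.nonneg
        · exact le_add_of_nonneg_left hP₁.posSemidef.nonneg⟩
    obtain ⟨γ, hγ, hbd⟩ := c.exists_uniform_bound hc t β
    obtain ⟨α, hα, hle⟩ := hrate γ hγ
    have hd := GRDE.thompson_pos hn hP₁ hP₂ hne
    refine (main _ P₁ P₂ _ α t hα.le ht.le hle hlt fun X hX h0 _ s hs =>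
      hbd t le_rfl X hX (hβS _ h0) s hs).trans_lt ?_
    refine mul_lt_of_lt_one_left hd ?_
    refine (Real.exp_lt_exp.2 ?_).trans_eq Real.exp_zero
    nlinarith
  · intro S hS hbS
    obtain ⟨β, hβ, hβS⟩ := hS1 S hS hbS
    obtain ⟨α, hα, hle⟩ := hrate β hβ
    exact ⟨α, hα, fun P₁ _ P₂ _ t ht hlt => main S P₁ P₂ _ α t hα.le ht hle hlt
      fun X _ _ hXS s hs => hβS _ (hXS s hs)⟩
  · intro S hS hbS T _
    obtain ⟨β, -, hβS⟩ := hS1 S hS hbS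
    obtain ⟨γ, hγ, hbd⟩ := c.exists_uniform_bound hc T β
    obtain ⟨α, hα, hle⟩ := hrate γ hγ
    refine ⟨α, hα, fun P₁ hP₁ P₂ hP₂ t ht htT hlt => main _ P₁ P₂ _ α t hα.le ht hle hlt
      fun X hX h0 _ s hs => hbd t htT X hX (hβS _ ?_) s hs⟩
    rcases h0 with h | h <;> rw [h] <;> assumption
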